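/- For a positive integer $j$, a sequence $\{w_n\}_{n\ge j}$ of non-negative real numbers is called a Hausdorff log-moment sequence if there is a positive Borel measure $\mu$ concentrated on $[0,1]$, whose restriction to $(0,1]$ is a Radon measure on $(0,1]$ (locally finite and inner regular), such that $w_n=\int_{[0,1]}t^{\log n}\,\mu(dt)$ for all $n\ge j$ (with $0^0=1$ and $0\cdot\infty=0$); such a $\mu$ is called a representing measure of $\{w_n\}_{n\ge j}$. For $a\ge 0$, a function $f:[a,\infty)\to[0,\infty)$ is completely monotone if it is continuous on $[a,\infty)$, infinitely differentiable on $(a,\infty)$, and $(-1)^kf^{(k)}\ge 0$ on $(a,\infty)$ for all integers $k\ge 0$. A representing measure of $f$ is a positive Radon measure $\nu$ concentrated on $[0,\infty)$ with $f(\lambda)=\int_{[0,\infty)}e^{-\lambda s}\,\nu(ds)$ for all $\lambda\ge a$. Let $\varphi:(0,1]\to[0,\infty)$, $\varphi(t)=-\log t$, and let $\varphi_*\mu$ be the pushforward under $\varphi$ of the restriction of $\mu$ to $(0,1]$; let $\chi_{\{1\}}$ denote the indicator function of $\{1\}$. **Theorem.** (i) Let $\{w_n\}_{n\ge1}$ be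 a sequence of non-negative real numbers. Then $\{w_n\}_{n\ge1}$ is a Hausdorff log-moment sequence if and only if there exists a unique completely monotone function $f:[0,\infty)\to[0,\infty)$ such that $f(0)\le w_1$ and $$w_n=(w_1-f(0))\,\chi_{\{1\}}(n)+f(\log n)\qquad(n\ge1);$$ moreover, the existence of such an $f$ already implies that $\{w_n\}_{n\ge1}$ is a Hausdorff log-moment sequence. If $\mu$ is a representing measure of $\{w_n\}_{n\ge1}$, then $\mu(\{0\})<\infty$ and $f(0)=w_1-\mu(\{0\})$. (ii) Let $j\ge2$ and let $\{w_n\}_{n\ge j}$ be a sequence of non-negative real numbers. Then $\{w_n\}_{n\ge j}$ is a Hausdorff log-moment sequence if and only if there exists a unique completely monotone function $f:[\log j,\infty)\to[0,\infty)$ such that $w_n=f(\log n)$ for all $n\ge j$; moreover, the existence of such an $f$ already implies that $\{w_n\}_{n\ge j}$ is a Hausdorff log-moment sequence. In either case, if $\mu$ is any representing measure of the sequence and $f$ is the corresponding completely monotone function, then $\varphi_*\mu$ is a representing measure of $f$, and it is the only one. -/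

import Mathlib

open MeasureTheory Set
open scoped NNReal

namespace HausdorffLog

/-- A Radon measure: a locally finite, inner regular Borel measure. -/
structure IsRadon {X : Type*} [TopologicalSpace X] [MeasurableSpace X] (μ : Measure X) : Prop where
  locallyFinite : IsLocallyFiniteMeasure μ
  innerRegular : μ.InnerRegular

/-- `μ` is a representing measure of the sequence `(w n)` for `n ≥ j`: a positive Borel measure
concentrated on `[0, 1]`, whose restriction to the space `(0, 1]` is a Radon measure (the mass of
`{0}` may be infinite), with `w n = ∫ t ^ log n ∂μ` for all `n ≥ j`. Here `0 ^ 0 = 1`. -/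
structure IsRepresentingMeasure (j : ℕ) (w : ℕ → ℝ) (μ : Measure ℝ) : Prop where
  concentrated : μ (Icc (0 : ℝ) 1)ᶜ = 0
  radon : IsRadon (μ.comap (Subtype.val : Ioc (0 : ℝ) 1 → ℝ))
  integrable : ∀ n : ℕ, j ≤ n → Integrable (fun t : ℝ => t ^ Real.log n) μ
  moment : ∀ n : ℕ, j ≤ n → w n = ∫ t, t ^ Real.log n ∂μ

/-- `(w n)`, `n ≥ j`, is a Hausdorff log-moment sequence. Only the values `w n` with `n ≥ j`
matter. -/
def IsHausdorffLogMoment (j : ℕ) (w : ℕ → ℝ) : Prop :=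
  (∀ n : ℕ, j ≤ n → 0 ≤ w n) ∧ ∃ μ : Measure ℝ, IsRepresentingMeasure j w μ

/-- `f : [a, ∞) → [0, ∞)` is completely monotone: continuous on `[a, ∞)`, smooth on `(a, ∞)`, and
`(-1) ^ k * f⁽ᵏ⁾ ≥ 0` on `(a, ∞)` for all `k`. The extension of `f` to `ℝ` (by the constant `f a` on
the left) serves only to speak of derivatives at points of the open set `(a, ∞)`. -/
structure IsCompletelyMonotone {a : ℝ} (f : Ici a → ℝ≥0) : Prop where
  continuous : Continuous f
  smooth : ContDiffOn ℝ ((⊤ : ℕ∞) : WithTop ℕ∞) (IciExtend fun x => (f x : ℝ)) (Ioi a)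
  alternating : ∀ k : ℕ, ∀ x ∈ Ioi a,
    0 ≤ (-1 : ℝ) ^ k * iteratedDeriv k (IciExtend fun x => (f x : ℝ)) x

/-- `ν` is a representing measure of `f : [a, ∞) → [0, ∞)`: a positive Radon measure concentrated
on `[0, ∞)` with `f x = ∫ exp (-x s) ν(ds)` for all `x ≥ a`. -/
structure IsLaplaceMeasure {a : ℝ} (f : Ici a → ℝ≥0) (ν : Measure ℝ) : Prop where
  concentrated : ν (Ici (0 : ℝ))ᶜ = 0
  radon : IsRadon ν
  integrable : ∀ x : Ici a, Integrable (fun s : ℝ => Real.exp (-(x : ℝ) * s)) ν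
  laplace : ∀ x : Ici a, (f x : ℝ) = ∫ s, Real.exp (-(x : ℝ) * s) ∂ν

/-- The pushforward of `μ` under `φ : (0, 1] → [0, ∞)`, `φ t = -log t`. -/
noncomputable def negLogPushforward (μ : Measure ℝ) : Measure ℝ :=
  (μ.restrict (Ioc (0 : ℝ) 1)).map fun t => -Real.log t

theorem log_mem_Ici {j n : ℕ} (h : j ≤ n) : Real.log n ∈ Ici (Real.log j) := by
  rcases Nat.eq_zero_or_pos j with rfl | hj
  · simpa using Real.log_natCast_nonneg n
  · exact Real.log_le_log (by exact_mod_cast hj) (by exact_mod_cast h)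

/-- `f : [0, ∞) → [0, ∞)` is completely monotone with `f 0 ≤ w 1` and
`w n = (w 1 - f 0) * χ_{1} n + f (log n)` for all `n ≥ 1`. -/
def InterpolatesFromOne (w : ℕ → ℝ) (f : Ici (0 : ℝ) → ℝ≥0) : Prop :=
  IsCompletelyMonotone f ∧ (f ⟨0, self_mem_Ici⟩ : ℝ) ≤ w 1 ∧
    ∀ n : ℕ, 1 ≤ n → w n = (w 1 - f ⟨0, self_mem_Ici⟩) * indicator {1} (fun _ : ℕ => (1 : ℝ)) n
      + f ⟨Real.log n, Real.log_natCast_nonneg n⟩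

/-- `f : [log j, ∞) → [0, ∞)` is completely monotone with `w n = f (log n)` for all `n ≥ j`. -/
def InterpolatesFrom (j : ℕ) (w : ℕ → ℝ) (f : Ici (Real.log j) → ℝ≥0) : Prop :=
  IsCompletelyMonotone f ∧ ∀ (n : ℕ) (hn : j ≤ n), w n = f ⟨Real.log n, log_mem_Ici hn⟩

end HausdorffLog

namespace HausdorffLog

/-! The substitution `t = exp (-s)` turns the log-moments of `μ` into values at `log n` of the
Laplace transform of `φ_*μ`. An atom at `t = 0`, even of infinite mass, is invisible when `log n ≠
0`. At `n = 1` the convention `0 ^ 0 = 1` makes it count with its full mass, whence the correction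
at `1`. Conversely, a completely monotone `f` is a Laplace transform by Bernstein's theorem; pushing
its measure back to `(0, 1]`, with an atom at `0` if needed, represents the sequence.

Uniqueness rests on Müntz's theorem: since `∑ 1 / log n` diverges, combinations of `exp (-(log n -
log j) s)`, `n > j`, approximate every `exp (-q s)`, `q > 0`, uniformly on `[0, ∞)`
(`exists_abs_exp_sub_sum_log_le`). So the values at `log n`, `n > j`, fix the transform to the right
of `log j`; an exponential weight makes the measure finite, and Weierstrass approximation determines
it (`ext_of_integral_exp_log_eq`).

Bernstein's theorem is reduced to the Hausdorff moment problem (`exists_measure_integral_pow_eq`):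
the samples of `f` on each grid of step `1 / (N + 1)` have nonnegative differences, and determinacy
makes the resulting measures compatible. -/

/-! ### Müntz approximation by exponentials -/

/-- One step of von Golitschek's proof of the Müntz theorem: a solution of
`R' + l * R = (l - q) * Q` that vanishes at `0` is small when `Q` is. -/
theorem abs_le_of_hasDerivAt_add_mul {Q R R' : ℝ → ℝ} {l q B : ℝ} (hl : 0 < l)
    (hR : ∀ s, HasDerivAt R (R' s) s) (h0 : R 0 = 0)
    (hode : ∀ s, R' s + l * R s = (l - q) * Q s) (hQ : ∀ s, 0 ≤ s → |Q s| ≤ B)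
    {s : ℝ} (hs : 0 ≤ s) : |R s| ≤ |1 - q / l| * B := by
  have hB : 0 ≤ B := (abs_nonneg _).trans (hQ 0 le_rfl)
  have hexp : ∀ t : ℝ, HasDerivAt (fun t => Real.exp (l * t)) (l * Real.exp (l * t)) t := by
    intro t
    have := ((hasDerivAt_id t).const_mul l).exp
    simpa [mul_comm] using this
  -- With the integrating factor `exp (l t)`, the derivative of `exp (l t) * R t` is dominated by
  -- that of `|1 - q / l| * B * (exp (l t) - 1)`.
  have hf : ∀ t, HasDerivAt (fun t => Real.exp (l * t) * R t)
      (Real.exp (l * t) * ((l - q) * Q t)) t := by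
    intro t
    refine ((hexp t).mul (hR t)).congr_deriv ?_
    rw [← hode t]; ring
  have hb : ∀ t, HasDerivAt (fun t => |1 - q / l| * B * Real.exp (l * t) - |1 - q / l| * B)
      (|1 - q / l| * B * (l * Real.exp (l * t))) t := fun t => ((hexp t).const_mul _).sub_const _
  have key := image_norm_le_of_norm_deriv_right_le_deriv_boundary (a := 0) (b := s)
    (f := fun t => Real.exp (l * t) * R t) (f' := fun t => Real.exp (l * t) * ((l - q) * Q t))
    (fun t _ => (hf t).continuousAt.continuousWithinAt)
    (fun t _ => (hf t).hasDerivWithinAt) (by simp [h0]) hb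
    (fun t ht => by
      have h1 : |l - q| = |1 - q / l| * l := by
        rw [← abs_of_pos hl, ← abs_mul, abs_of_pos hl]; congr 1; field_simp
      rw [Real.norm_eq_abs, abs_mul, abs_mul, Real.abs_exp, h1]
      have := mul_le_mul_of_nonneg_left (hQ t ht.1)
        (mul_nonneg (Real.exp_pos (l * t)).le (mul_nonneg (abs_nonneg (1 - q / l)) hl.le))
      linarith) (right_mem_Icc.2 hs)
  rw [Real.norm_eq_abs, abs_mul, Real.abs_exp] at key
  have hpos := Real.exp_pos (l * s)
  have : Real.exp (l * s) * |R s| ≤ Real.exp (l * s) * (|1 - q / l| * B) := by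
    have := mul_nonneg (abs_nonneg (1 - q / l)) hB
    linarith
  exact le_of_mul_le_mul_left this hpos

/-- Quantitative Müntz approximation of an exponential by other exponentials. -/
theorem exists_abs_exp_sub_sum_le {l : ℕ → ℝ} (hl : ∀ n, 0 < l n) (hinj : Function.Injective l)
    {q : ℝ} (hq : 0 < q) (N : ℕ) : ∃ c : ℕ → ℝ, ∀ s : ℝ, 0 ≤ s →
      |Real.exp (-q * s) - ∑ k ∈ Finset.range N, c k * Real.exp (-l k * s)|
        ≤ ∏ k ∈ Finset.range N, |1 - q / l k| := by
  induction N with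
  | zero =>
    refine ⟨0, fun s hs => ?_⟩
    simp only [Finset.range_zero, Finset.sum_empty, sub_zero, Finset.prod_empty, Real.abs_exp]
    exact Real.exp_le_one_iff.2 (by nlinarith)
  | succ N ih =>
    obtain ⟨c, hc⟩ := ih
    -- The new remainder solves the ODE of the previous lemma with the old remainder as `Q`. Each
    -- `exp (-l k s)` in `Q` responds with the factor `(l N - q) / (l N - l k)`, while `exp (-q s)`
    -- keeps coefficient `1`. The homogeneous solution `exp (-l N s)` is added so that the remainder
    -- vanishes at `0`.
    set d : ℕ → ℝ := fun k => c k * ((l N - q) / (l N - l k)) with hd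
    refine ⟨fun k => if k < N then d k else 1 - ∑ i ∈ Finset.range N, d i, fun s hs => ?_⟩
    have hsum : ∀ s : ℝ, ∑ k ∈ Finset.range (N + 1),
        (if k < N then d k else 1 - ∑ i ∈ Finset.range N, d i) * Real.exp (-l k * s)
        = ∑ k ∈ Finset.range N, d k * Real.exp (-l k * s)
          + (1 - ∑ i ∈ Finset.range N, d i) * Real.exp (-l N * s) := by
      intro s
      rw [Finset.sum_range_succ, if_neg (lt_irrefl N)]
      congr 1
      exact Finset.sum_congr rfl fun k hk => by rw [if_pos (Finset.mem_range.1 hk)]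
    rw [hsum, Finset.prod_range_succ, mul_comm (∏ k ∈ Finset.range N, |1 - q / l k|)]
    have hexp : ∀ p t : ℝ, HasDerivAt (fun t => Real.exp (-p * t)) (-p * Real.exp (-p * t)) t := by
      intro p t
      have := ((hasDerivAt_id t).const_mul (-p)).exp
      simpa [mul_comm] using this
    refine abs_le_of_hasDerivAt_add_mul (q := q) (hl N)
      (R := fun s => Real.exp (-q * s) - (∑ k ∈ Finset.range N, d k * Real.exp (-l k * s)
          + (1 - ∑ i ∈ Finset.range N, d i) * Real.exp (-l N * s)))
      (fun t => (hexp q t).sub ((HasDerivAt.fun_sum fun k _ => (hexp (l k) t).const_mul (d k)).add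
        ((hexp (l N) t).const_mul _))) ?_ ?_ hc hs
    · simp
    · intro t
      have h1 : ∑ k ∈ Finset.range N, c k * Real.exp (-l k * t) * (l N - q)
          = ∑ k ∈ Finset.range N, d k * Real.exp (-l k * t) * (l N - l k) := by
        refine Finset.sum_congr rfl fun k hk => ?_
        have : l N - l k ≠ 0 := sub_ne_zero.2 fun h =>
          (Finset.mem_range.1 hk).ne' (hinj h)
        simp only [hd]
        field_simp
      have h2 : ∑ k ∈ Finset.range N, d k * Real.exp (-l k * t) * (l N - l k)
          = l N * ∑ k ∈ Finset.range N, d k * Real.exp (-l k * t)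
            + ∑ k ∈ Finset.range N, d k * (-l k * Real.exp (-l k * t)) := by
        rw [Finset.mul_sum, ← Finset.sum_add_distrib]
        exact Finset.sum_congr rfl fun k _ => by ring
      have h3 : (l N - q) * (Real.exp (-q * t) - ∑ k ∈ Finset.range N, c k * Real.exp (-l k * t))
          = (l N - q) * Real.exp (-q * t)
            - ∑ k ∈ Finset.range N, c k * Real.exp (-l k * t) * (l N - q) := by
        rw [← Finset.sum_mul]; ring
      rw [h3, h1, h2]
      ring

/-- Since `q ≤ l k`, each factor lies between `0` and `exp (-q / l k)`, and the exponents sum to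
`-∞`. -/
theorem tendsto_prod_abs_one_sub_div {l : ℕ → ℝ} {q : ℝ} (hq : 0 < q) (hl : ∀ n, q ≤ l n)
    (hdiv : ¬ Summable fun n => (l n)⁻¹) :
    Filter.Tendsto (fun N => ∏ k ∈ Finset.range N, |1 - q / l k|) Filter.atTop (nhds 0) := by
  have hpos : ∀ n, 0 < l n := fun n => hq.trans_le (hl n)
  have hsum : Filter.Tendsto (fun N => ∑ k ∈ Finset.range N, (l k)⁻¹) Filter.atTop Filter.atTop :=
    (not_summable_iff_tendsto_nat_atTop_of_nonneg fun n => (inv_pos.2 (hpos n)).le).1 hdiv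
  refine squeeze_zero (g := fun N => Real.exp (-(q * ∑ k ∈ Finset.range N, (l k)⁻¹)))
    (fun N => Finset.prod_nonneg fun k _ => abs_nonneg _) (fun N => ?_)
    (Real.tendsto_exp_neg_atTop_nhds_zero.comp (hsum.const_mul_atTop hq))
  rw [Finset.mul_sum, ← Finset.sum_neg_distrib, Real.exp_sum]
  refine Finset.prod_le_prod (fun k _ => abs_nonneg _) fun k _ => ?_
  rw [abs_of_nonneg (sub_nonneg.2 ((div_le_one (hpos k)).2 (hl k)))]
  have := Real.add_one_le_exp (-(q * (l k)⁻¹))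
  rw [div_eq_mul_inv]; linarith

/-- The exponentials with exponents `log n - log j`, `n > j`, approximate every decaying
exponential uniformly on `[0, ∞)`. -/
theorem exists_abs_exp_sub_sum_log_le {j : ℕ} (hj : 1 ≤ j) {q ε : ℝ} (hq : 0 < q) (hε : 0 < ε) :
    ∃ (S : Finset ℕ) (c : ℕ → ℝ), (∀ n ∈ S, j < n) ∧ ∀ s : ℝ, 0 ≤ s →
      |Real.exp (-q * s) - ∑ n ∈ S, c n * Real.exp (-(Real.log n - Real.log j) * s)| ≤ ε := by
  have hj0 : (0 : ℝ) < j := by exact_mod_cast hj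
  -- Starting at `n₀ ≥ j * exp q` makes every exponent `log (n₀ + k) - log j` at least `q`.
  obtain ⟨n₀, hn₀⟩ := exists_nat_ge (j * Real.exp q)
  have hn₀j : (j : ℝ) < n₀ := by
    have := Real.add_one_lt_exp hq.ne'
    nlinarith
  have hn₀0 : (0 : ℝ) < n₀ := hj0.trans hn₀j
  set l : ℕ → ℝ := fun k => Real.log (n₀ + k : ℕ) - Real.log j with hldef
  have hl : ∀ k, q ≤ l k := fun k => by
    have h1 : Real.log (j * Real.exp q) ≤ Real.log (n₀ + k : ℕ) := by
      refine Real.log_le_log (by positivity) (hn₀.trans ?_)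
      push_cast
      linarith [(Nat.cast_nonneg k : (0 : ℝ) ≤ k)]
    rw [Real.log_mul hj0.ne' (Real.exp_pos q).ne', Real.log_exp] at h1
    simp only [hldef]; linarith
  have hdiv : ¬ Summable fun n => (l n)⁻¹ := by
    intro hs
    have h2 : Summable fun k : ℕ => ((n₀ + k : ℕ) : ℝ)⁻¹ := by
      refine hs.of_nonneg_of_le (fun k => by positivity) fun k => ?_
      refine inv_anti₀ (hq.trans_le (hl k)) ?_
      have h3 : Real.log (n₀ + k : ℕ) ≤ (n₀ + k : ℕ) := Real.log_le_self (by positivity)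
      have h4 : 0 ≤ Real.log j := Real.log_natCast_nonneg j
      simp only [hldef]; linarith
    have h5 : Summable fun k : ℕ => ((k + n₀ : ℕ) : ℝ)⁻¹ := by simpa only [add_comm] using h2
    exact Real.not_summable_natCast_inv ((summable_nat_add_iff n₀).1 h5)
  have hinj : Function.Injective l := by
    intro a b hab
    have h6 : Real.log (n₀ + a : ℕ) = Real.log (n₀ + b : ℕ) := by
      simp only [hldef] at hab; linarith
    have h7 := Real.log_injOn_pos
      (show ((n₀ + a : ℕ) : ℝ) ∈ Ioi 0 by simp only [mem_Ioi]; push_cast; positivity)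
      (show ((n₀ + b : ℕ) : ℝ) ∈ Ioi 0 by simp only [mem_Ioi]; push_cast; positivity) h6
    have h8 : n₀ + a = n₀ + b := by exact_mod_cast h7
    omega
  obtain ⟨N, hN⟩ := ((tendsto_prod_abs_one_sub_div hq hl hdiv).eventually
    (ge_mem_nhds hε)).exists
  obtain ⟨c, hc⟩ := exists_abs_exp_sub_sum_le (fun n => hq.trans_le (hl n)) hinj hq N
  have hn₀j' : j < n₀ := by exact_mod_cast hn₀j
  refine ⟨(Finset.range N).map (addLeftEmbedding n₀), fun n => c (n - n₀), ?_, fun s hs => ?_⟩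
  · intro n hn
    obtain ⟨k, -, rfl⟩ := Finset.mem_map.1 hn
    simp only [addLeftEmbedding_apply]; omega
  · refine le_trans (le_of_eq ?_) ((hc s hs).trans hN)
    rw [Finset.sum_map]
    simp [hldef]

/-! ### Determinacy of moments and Laplace transforms -/

/-- A finite measure on the unit interval is determined by its moments. -/
theorem ext_of_integral_pow_eq {P Q : Measure unitInterval} [IsFiniteMeasure P] [IsFiniteMeasure Q]
    (h : ∀ k : ℕ, ∫ x, (x : ℝ) ^ k ∂P = ∫ x, (x : ℝ) ^ k ∂Q) : P = Q := by
  have hint : ∀ (m : Measure unitInterval) [IsFiniteMeasure m] (f : C(unitInterval, ℝ)),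
      Integrable f m := fun m _ f => f.continuous.integrable_of_hasCompactSupport
        (HasCompactSupport.of_compactSpace f)
  have hpoly : ∀ p : Polynomial ℝ, ∫ x : unitInterval, p.eval (x : ℝ) ∂P
      = ∫ x : unitInterval, p.eval (x : ℝ) ∂Q := by
    intro p
    simp only [Polynomial.eval_eq_sum_range]
    have hi : ∀ (m : Measure unitInterval) [IsFiniteMeasure m], ∀ i ∈ Finset.range (p.natDegree + 1),
        Integrable (fun x : unitInterval => p.coeff i * (x : ℝ) ^ i) m := fun m _ i _ =>
      hint m ⟨fun x => p.coeff i * (x : ℝ) ^ i, by fun_prop⟩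
    rw [integral_finsetSum _ (hi P), integral_finsetSum _ (hi Q)]
    exact Finset.sum_congr rfl fun i _ => by rw [integral_const_mul, integral_const_mul, h]
  have hcont : ∀ (m : Measure unitInterval) [IsFiniteMeasure m],
      Continuous fun f : C(unitInterval, ℝ) => ∫ x, f x ∂m := by
    intro m _
    refine (LipschitzWith.of_dist_le_mul (K := (m.real univ).toNNReal)
      fun f g => ?_).continuous
    rw [dist_eq_norm, ← integral_sub (hint m f) (hint m g), Real.coe_toNNReal _ measureReal_nonneg,
      mul_comm]
    refine norm_integral_le_of_norm_le_const (Filter.Eventually.of_forall fun x => ?_)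
    rw [← dist_eq_norm]
    exact ContinuousMap.dist_apply_le_dist x
  refine ext_of_forall_integral_eq_of_IsFiniteMeasure fun f => ?_
  have hclosed : IsClosed {f : C(unitInterval, ℝ) | (∫ x, f x ∂P) = (∫ x, f x ∂Q)} :=
    isClosed_eq (hcont P) (hcont Q)
  have hle : ((polynomialFunctions unitInterval).topologicalClosure : Set C(unitInterval, ℝ)) ⊆
      {f : C(unitInterval, ℝ) | (∫ x, f x ∂P) = (∫ x, f x ∂Q)} := by
    refine closure_minimal ?_ hclosed
    intro f hf
    obtain ⟨p, -, rfl⟩ := hf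
    simpa using hpoly p
  have htop := polynomialFunctions_closure_eq_top 0 1
  exact hle (htop ▸ Algebra.mem_top : f.toContinuousMap ∈ _)

/-- The homeomorphism `s ↦ exp (-s)` of `[0, ∞)` onto `(0, 1]`, extended by `1` to the left. -/
noncomputable def expNeg (s : ℝ) : unitInterval :=
  ⟨Real.exp (-max s 0), (Real.exp_pos _).le, Real.exp_le_one_iff.2 (by simp)⟩

theorem measurable_expNeg : Measurable expNeg :=
  Continuous.measurable (by unfold expNeg; fun_prop)

theorem coe_expNeg {s : ℝ} (hs : 0 ≤ s) : (expNeg s : ℝ) = Real.exp (-s) := by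
  simp [expNeg, hs]

theorem ae_nonneg_of_concentrated {ν : Measure ℝ} (h : ν (Ici (0 : ℝ))ᶜ = 0) :
    ∀ᵐ s ∂ν, 0 ≤ s := h

/-- A finite measure on `[0, ∞)` is determined by the values of its Laplace transform at the
natural numbers. -/
theorem ext_of_integral_exp_natCast_eq {m₁ m₂ : Measure ℝ} [IsFiniteMeasure m₁]
    [IsFiniteMeasure m₂] (h₁ : m₁ (Ici (0 : ℝ))ᶜ = 0) (h₂ : m₂ (Ici (0 : ℝ))ᶜ = 0)
    (h : ∀ k : ℕ, ∫ s, Real.exp (-(k : ℝ) * s) ∂m₁ = ∫ s, Real.exp (-(k : ℝ) * s) ∂m₂) :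
    m₁ = m₂ := by
  have hg : Measurable fun x : unitInterval => -Real.log x := by fun_prop
  have hback : ∀ m : Measure ℝ, m (Ici (0 : ℝ))ᶜ = 0 →
      (m.map expNeg).map (fun x : unitInterval => -Real.log x) = m := by
    intro m hm
    rw [Measure.map_map hg measurable_expNeg]
    conv_rhs => rw [← Measure.map_id (μ := m)]
    refine Measure.map_congr ?_
    filter_upwards [ae_nonneg_of_concentrated hm] with s hs
    simp [coe_expNeg hs]
  have hmom : ∀ m : Measure ℝ, m (Ici (0 : ℝ))ᶜ = 0 → ∀ k : ℕ,
      ∫ x, (x : ℝ) ^ k ∂(m.map expNeg) = ∫ s, Real.exp (-(k : ℝ) * s) ∂m := by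
    intro m hm k
    rw [integral_map measurable_expNeg.aemeasurable
      (Continuous.aestronglyMeasurable (by fun_prop))]
    refine integral_congr_ae ?_
    filter_upwards [ae_nonneg_of_concentrated hm] with s hs
    rw [coe_expNeg hs, ← Real.exp_nat_mul]
    congr 1; ring
  have := ext_of_integral_pow_eq (P := m₁.map expNeg) (Q := m₂.map expNeg) fun k => by
    rw [hmom m₁ h₁, hmom m₂ h₂, h]
  rw [← hback m₁ h₁, ← hback m₂ h₂, this]

theorem integrable_exp_of_le {ν : Measure ℝ} (h : ν (Ici (0 : ℝ))ᶜ = 0) {a b : ℝ} (hab : a ≤ b)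
    (ha : Integrable (fun s => Real.exp (-a * s)) ν) :
    Integrable (fun s => Real.exp (-b * s)) ν := by
  refine ha.mono' (Continuous.aestronglyMeasurable (by fun_prop)) ?_
  filter_upwards [ae_nonneg_of_concentrated h] with s hs
  rw [Real.norm_eq_abs, Real.abs_exp]
  exact Real.exp_le_exp.2 (by nlinarith)

theorem integral_exp_withDensity (ν : Measure ℝ) (a b : ℝ) :
    ∫ s, Real.exp (-b * s) ∂(ν.withDensity fun s => ENNReal.ofReal (Real.exp (-a * s)))
      = ∫ s, Real.exp (-(a + b) * s) ∂ν := by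
  rw [integral_withDensity_eq_integral_toReal_smul (by fun_prop)
    (Filter.Eventually.of_forall fun _ => ENNReal.ofReal_lt_top)]
  refine integral_congr_ae (Filter.Eventually.of_forall fun s => ?_)
  simp only [smul_eq_mul]
  rw [ENNReal.toReal_ofReal (Real.exp_pos _).le, ← Real.exp_add]
  congr 1; ring

/-- A measure on `[0, ∞)` is determined by the values of its Laplace transform on the set of all
`log n`, `n > j`. -/
theorem ext_of_integral_exp_log_eq {j : ℕ} (hj : 1 ≤ j) {ν₁ ν₂ : Measure ℝ}
    (h₁ : ν₁ (Ici (0 : ℝ))ᶜ = 0) (h₂ : ν₂ (Ici (0 : ℝ))ᶜ = 0)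
    (hi₁ : Integrable (fun s => Real.exp (-Real.log j * s)) ν₁)
    (hi₂ : Integrable (fun s => Real.exp (-Real.log j * s)) ν₂)
    (h : ∀ n : ℕ, j < n →
      ∫ s, Real.exp (-Real.log n * s) ∂ν₁ = ∫ s, Real.exp (-Real.log n * s) ∂ν₂) :
    ν₁ = ν₂ := by
  set a := Real.log j with ha
  have hle : ∀ n : ℕ, j < n → a ≤ Real.log n := fun n hn =>
    Real.log_le_log (by exact_mod_cast hj) (by exact_mod_cast hn.le)
  -- the transforms agree to the right of `a`
  have hright : ∀ q : ℝ, 0 < q →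
      ∫ s, Real.exp (-(a + q) * s) ∂ν₁ = ∫ s, Real.exp (-(a + q) * s) ∂ν₂ := by
    intro q hq
    have hbound : ∀ ε : ℝ, 0 < ε →
        |∫ s, Real.exp (-(a + q) * s) ∂ν₁ - ∫ s, Real.exp (-(a + q) * s) ∂ν₂|
          ≤ ε * (∫ s, Real.exp (-a * s) ∂ν₁ + ∫ s, Real.exp (-a * s) ∂ν₂) := by
      intro ε hε
      obtain ⟨S, c, hS, hc⟩ := exists_abs_exp_sub_sum_log_le hj hq hε
      have hone : ∀ ν : Measure ℝ, ν (Ici (0 : ℝ))ᶜ = 0 →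
          Integrable (fun s => Real.exp (-a * s)) ν →
          |∫ s, Real.exp (-(a + q) * s) ∂ν - ∑ n ∈ S, c n * ∫ s, Real.exp (-Real.log n * s) ∂ν|
            ≤ ε * ∫ s, Real.exp (-a * s) ∂ν := by
        intro ν hν hi
        have hin : ∀ n ∈ S, Integrable (fun s => c n * Real.exp (-Real.log n * s)) ν :=
          fun n hn => (integrable_exp_of_le hν (hle n (hS n hn)) hi).const_mul _
        simp_rw [← integral_const_mul]
        rw [← integral_finsetSum _ hin, ← integral_sub
          (integrable_exp_of_le hν (by linarith) hi) (integrable_finsetSum _ hin),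
          ← Real.norm_eq_abs]
        refine norm_integral_le_of_norm_le (hi.const_mul ε) ?_
        filter_upwards [ae_nonneg_of_concentrated hν] with s hs
        -- Factoring out `exp (-a s)` leaves the uniformly small Müntz error against an integrable
        -- weight, although `ν` may be infinite.
        have hfac : Real.exp (-(a + q) * s) - ∑ n ∈ S, c n * Real.exp (-Real.log n * s)
            = Real.exp (-a * s) * (Real.exp (-q * s)
              - ∑ n ∈ S, c n * Real.exp (-(Real.log n - a) * s)) := by
          rw [mul_sub, ← Real.exp_add, Finset.mul_sum]
          congr 1
          · congr 1; ring
          · refine Finset.sum_congr rfl fun n _ => ?_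
            rw [mul_left_comm, ← Real.exp_add]
            congr 2; ring
        rw [hfac, Real.norm_eq_abs, abs_mul, Real.abs_exp, mul_comm ε]
        exact mul_le_mul_of_nonneg_left (hc s hs) (Real.exp_pos _).le
      have e₁ := hone ν₁ h₁ hi₁
      have e₂ := hone ν₂ h₂ hi₂
      have e₃ : ∑ n ∈ S, c n * ∫ s, Real.exp (-Real.log n * s) ∂ν₁
          = ∑ n ∈ S, c n * ∫ s, Real.exp (-Real.log n * s) ∂ν₂ :=
        Finset.sum_congr rfl fun n hn => by rw [h n (hS n hn)]
      rw [e₃] at e₁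
      rw [abs_le] at e₁ e₂ ⊢
      constructor <;> linarith [e₁.1, e₁.2, e₂.1, e₂.2]
    have hM : 0 ≤ ∫ s, Real.exp (-a * s) ∂ν₁ + ∫ s, Real.exp (-a * s) ∂ν₂ :=
      add_nonneg (integral_nonneg fun s => (Real.exp_pos _).le)
        (integral_nonneg fun s => (Real.exp_pos _).le)
    set M := ∫ s, Real.exp (-a * s) ∂ν₁ + ∫ s, Real.exp (-a * s) ∂ν₂
    rw [← sub_eq_zero, ← abs_nonpos_iff]
    refine le_of_forall_pos_le_add fun δ hδ => ?_
    refine (hbound (δ / (M + 1)) (by positivity)).trans ?_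
    rw [zero_add, div_mul_eq_mul_div, div_le_iff₀ (by positivity)]
    nlinarith
  -- The weight has exponent `a + 1`, not `a`, so that the natural exponent `k = 0` also falls
  -- strictly to the right of `a`, where `hright` applies.
  set ρ : ℝ → ENNReal := fun s => ENNReal.ofReal (Real.exp (-(a + 1) * s)) with hρ
  have hρm : Measurable ρ := by fun_prop
  have hfin : ∀ ν : Measure ℝ, ν (Ici (0 : ℝ))ᶜ = 0 →
      Integrable (fun s => Real.exp (-a * s)) ν → IsFiniteMeasure (ν.withDensity ρ) :=
    fun ν hν hi => isFiniteMeasure_withDensity_ofReal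
      (integrable_exp_of_le hν (by linarith) hi).2
  have := hfin ν₁ h₁ hi₁
  have := hfin ν₂ h₂ hi₂
  have heq : ν₁.withDensity ρ = ν₂.withDensity ρ := by
    refine ext_of_integral_exp_natCast_eq (withDensity_absolutelyContinuous _ _ h₁)
      (withDensity_absolutelyContinuous _ _ h₂) fun k => ?_
    rw [hρ, integral_exp_withDensity, integral_exp_withDensity, add_assoc]
    exact hright _ (by positivity)
  have hinv : ∀ ν : Measure ℝ, (ν.withDensity ρ).withDensity ρ⁻¹ = ν := fun ν =>
    withDensity_inv_same hρm
      (Filter.Eventually.of_forall fun s => by simp [hρ, Real.exp_pos])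
      (Filter.Eventually.of_forall fun s => ENNReal.ofReal_ne_top)
  rw [← hinv ν₁, ← hinv ν₂, heq]

/-! ### The Hausdorff moment problem -/

/-- The backward difference operator `w ↦ (k ↦ w k - w (k + 1))`. -/
noncomputable def diffEnd : Module.End ℝ (ℕ → ℝ) := 1 - LinearMap.funLeft ℝ ℝ Nat.succ

theorem diffEnd_apply (w : ℕ → ℝ) (k : ℕ) : diffEnd w k = w k - w (k + 1) := rfl

theorem funLeft_succ_pow_apply (i : ℕ) (w : ℕ → ℝ) (k : ℕ) :
    ((LinearMap.funLeft ℝ ℝ Nat.succ) ^ i) w k = w (k + i) := by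
  induction i generalizing k with
  | zero => rfl
  | succ i ih =>
    rw [pow_succ', Module.End.mul_apply, LinearMap.funLeft_apply, ih]
    congr 1; omega

/-- This is the binomial theorem for the shift and the difference operator, which commute and sum to
the identity. -/
theorem sum_choose_mul_diffEnd_pow (w : ℕ → ℝ) (m r : ℕ) :
    ∑ i ∈ Finset.range (m + 1), (m.choose i : ℝ) * (diffEnd ^ (m - i)) w (r + i) = w r := by
  have hc : Commute (LinearMap.funLeft ℝ ℝ Nat.succ) diffEnd :=
    (Commute.one_right _).sub_right (Commute.refl _)
  have h := hc.add_pow m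
  rw [show LinearMap.funLeft ℝ ℝ Nat.succ + diffEnd = 1 by simp [diffEnd], one_pow] at h
  have h' := congrFun (congrArg (fun T : Module.End ℝ (ℕ → ℝ) => T w) h) r
  simp only [Module.End.one_apply, LinearMap.sum_apply, Finset.sum_apply] at h'
  rw [h']
  refine Finset.sum_congr rfl fun i _ => ?_
  rw [← nsmul_eq_mul', LinearMap.smul_apply, Pi.smul_apply, Module.End.mul_apply,
    funLeft_succ_pow_apply, nsmul_eq_mul]

/-- From `(n choose k) (k choose r) = (n choose r) (n - r choose k - r)`. It gives the discrete
measures below exact factorial moments. -/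
theorem sum_choose_mul_choose_mul_diffEnd_pow (w : ℕ → ℝ) {n r : ℕ} (hr : r ≤ n) :
    ∑ k ∈ Finset.range (n + 1), (k.choose r : ℝ) * (n.choose k * (diffEnd ^ (n - k)) w k)
      = n.choose r * w r := by
  obtain ⟨m, rfl⟩ := Nat.exists_eq_add_of_le hr
  rw [show r + m + 1 = r + (m + 1) by ring, Finset.sum_range_add, Finset.sum_eq_zero, zero_add,
    ← sum_choose_mul_diffEnd_pow w m r, Finset.mul_sum]
  · refine Finset.sum_congr rfl fun i hi => ?_
    have h := Nat.choose_mul (n := r + m) (k := r + i) (s := r) (by omega)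
    rw [show r + m - r = m by omega, show r + i - r = i by omega] at h
    have h' : ((r + m).choose (r + i) : ℝ) * (r + i).choose r = (r + m).choose r * m.choose i := by
      exact_mod_cast h
    rw [show r + m - (r + i) = m - i by omega]
    linear_combination (diffEnd ^ (m - i)) w (r + i) * h'
  · intro k hk
    rw [Nat.choose_eq_zero_of_lt (Finset.mem_range.1 hk)]
    simp

/-- The quotient is a product of factors `(k - i) / (n - i)`, each within `i / (n - i)` of `k / n`.
All factors lie in `[0, 1]`, so the errors add. -/
theorem abs_pow_sub_descFactorial_div_le {n k : ℕ} (hk : k ≤ n) {r : ℕ} (hr : r ≤ n) :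
    |((k : ℝ) / n) ^ r - (k.descFactorial r : ℝ) / n.descFactorial r|
      ≤ ∑ i ∈ Finset.range r, (i : ℝ) / (n - i) := by
  induction r with
  | zero => simp
  | succ r ih =>
    have hrn : (r : ℝ) < n := by exact_mod_cast hr
    have hr0 : (0 : ℝ) ≤ r := Nat.cast_nonneg r
    have hn : (0 : ℝ) < n := hr0.trans_lt hrn
    have hkn : (k : ℝ) ≤ n := by exact_mod_cast hk
    have hk0 : (0 : ℝ) ≤ k := Nat.cast_nonneg k
    have hd : (0 : ℝ) < n - r := sub_pos.2 hrn
    have hD : (0 : ℝ) < n.descFactorial r := by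
      exact_mod_cast Nat.pos_of_ne_zero fun h0 =>
        absurd (Nat.descFactorial_eq_zero_iff_lt.1 h0) (by omega)
    rw [Finset.sum_range_succ, Nat.descFactorial_succ, Nat.descFactorial_succ]
    push_cast
    rw [Nat.cast_sub (by omega : r ≤ n)]
    set p := (k.descFactorial r : ℝ) / n.descFactorial r with hp
    have hp0 : 0 ≤ p := by positivity
    have hp1 : p ≤ 1 := (div_le_one hD).2 (by exact_mod_cast Nat.descFactorial_le r hk)
    have hx : |(k : ℝ) / n - ((k - r : ℕ) : ℝ) / (n - r)| ≤ r / (n - r) := by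
      -- For `k ≤ r` the truncated subtraction gives `0`, and `k / n` itself is at most `r / (n -
      -- r)`.
      rcases le_total r k with h | h
      · rw [Nat.cast_sub h, div_sub_div _ _ hn.ne' hd.ne', abs_of_nonneg, div_le_div_iff₀]
        · have : 0 ≤ (n - r : ℝ) * (r * k) := by positivity
          nlinarith
        · positivity
        · exact hd
        · refine div_nonneg ?_ (by positivity)
          nlinarith
      · rw [Nat.sub_eq_zero_of_le h, Nat.cast_zero, zero_div, sub_zero, abs_of_nonneg (by positivity)]
        have : (k : ℝ) ≤ r := by exact_mod_cast h
        exact div_le_div₀ hr0 this hd (by linarith)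
    have hsplit : ((k : ℝ) / n) ^ (r + 1)
        - ((k - r : ℕ) : ℝ) * k.descFactorial r / ((n - r) * n.descFactorial r)
        = (((k : ℝ) / n) ^ r - p) * (k / n) + p * (k / n - ((k - r : ℕ) : ℝ) / (n - r)) := by
      rw [mul_div_mul_comm, ← hp]; ring
    rw [hsplit]
    refine (abs_add_le _ _).trans (add_le_add ?_ ?_)
    · rw [abs_mul]
      refine (mul_le_of_le_one_right (abs_nonneg _) ?_).trans (ih (by omega))
      rw [abs_of_nonneg (by positivity)]
      exact (div_le_one hn).2 hkn
    · rw [abs_mul, abs_of_nonneg hp0]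
      exact (mul_le_of_le_one_left (abs_nonneg _) hp1).trans hx

/-- The existence part of the Hausdorff moment problem. -/
theorem exists_measure_integral_pow_eq {w : ℕ → ℝ} (hw : ∀ n k, 0 ≤ (diffEnd ^ n) w k) :
    ∃ P : Measure unitInterval, IsFiniteMeasure P ∧ ∀ r : ℕ, ∫ x, (x : ℝ) ^ r ∂P = w r := by
  let pt : ℕ → ℕ → unitInterval := fun n k => projIcc 0 1 zero_le_one ((k : ℝ) / n)
  let c : ℕ → ℕ → ℝ := fun n k => n.choose k * (diffEnd ^ (n - k)) w k
  have hc : ∀ n k, 0 ≤ c n k := fun n k => mul_nonneg (Nat.cast_nonneg _) (hw _ _)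
  have hpt : ∀ n k, k ≤ n → (pt n k : ℝ) = k / n := by
    intro n k hk
    have : (k : ℝ) / n ∈ Icc (0 : ℝ) 1 :=
      ⟨by positivity, div_le_one_of_le₀ (by exact_mod_cast hk) (by positivity)⟩
    simp only [pt, projIcc_of_mem zero_le_one this]
  let m : ℕ → Measure unitInterval := fun n =>
    ∑ k ∈ Finset.range (n + 1), ENNReal.ofReal (c n k) • Measure.dirac (pt n k)
  have hfin : ∀ n, IsFiniteMeasure (m n) := fun n => by
    refine ⟨?_⟩
    simp [m, Measure.finsetSum_apply]
  have hint : ∀ n (g : unitInterval → ℝ), ∫ x, g x ∂(m n)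
      = ∑ k ∈ Finset.range (n + 1), c n k * g (pt n k) := by
    intro n g
    rw [integral_finsetSum_measure]
    · refine Finset.sum_congr rfl fun k _ => ?_
      rw [integral_smul_measure, integral_dirac, ENNReal.toReal_ofReal (hc n k), smul_eq_mul]
    · intro k _
      exact (integrable_dirac (by simp)).smul_measure ENNReal.ofReal_ne_top
  have hmass : ∀ n, ∑ k ∈ Finset.range (n + 1), c n k = w 0 := by
    intro n
    simpa using sum_choose_mul_choose_mul_diffEnd_pow w (Nat.zero_le n)
  have hw0 : 0 ≤ w 0 := hw 0 0
  let μ : ℕ → FiniteMeasure unitInterval := fun n => ⟨m n, hfin n⟩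
  have hμ : ∀ n, (μ n).mass ≤ (w 0).toNNReal := by
    intro n
    rw [← ENNReal.coe_le_coe, FiniteMeasure.ennreal_mass]
    change m n univ ≤ ENNReal.ofReal (w 0)
    rw [← hmass n, ENNReal.ofReal_sum_of_nonneg fun k _ => hc n k]
    simp [m, Measure.finsetSum_apply]
  -- Measures of mass at most `w 0` on a compact space form a compact set. A cluster point suffices,
  -- because the moments converge along the whole sequence.
  obtain ⟨P, -, hP⟩ := (isCompact_setOfPred_finiteMeasure_le_of_compactSpace unitInterval
    (w 0).toNNReal).exists_mapClusterPt_of_frequently (l := Filter.atTop) (f := μ)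
    (Filter.Frequently.of_forall hμ)
  refine ⟨P, inferInstance, fun r => ?_⟩
  -- convergence of the moments
  have hlim : Filter.Tendsto (fun n => ∫ x, (x : ℝ) ^ r ∂(m n)) Filter.atTop (nhds (w r)) := by
    have hE : Filter.Tendsto (fun n : ℕ => w 0 * ∑ i ∈ Finset.range r, (i : ℝ) / (n - i))
        Filter.atTop (nhds 0) := by
      rw [← mul_zero (w 0)]
      refine Filter.Tendsto.const_mul _ ?_
      rw [← Finset.sum_const_zero (s := Finset.range r)]
      refine tendsto_finsetSum _ fun i _ => ?_
      exact tendsto_const_nhds.div_atTop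
        (Filter.tendsto_atTop_add_const_right _ _ tendsto_natCast_atTop_atTop)
    rw [tendsto_iff_norm_sub_tendsto_zero]
    refine squeeze_zero' (Filter.Eventually.of_forall fun n => norm_nonneg _) ?_ hE
    filter_upwards [Filter.eventually_ge_atTop r] with n hn
    have hch : (0 : ℝ) < n.choose r := by exact_mod_cast Nat.choose_pos hn
    have hwr : w r = ∑ k ∈ Finset.range (n + 1), c n k * ((k.descFactorial r : ℝ)
        / n.descFactorial r) := by
      have h := sum_choose_mul_choose_mul_diffEnd_pow w hn
      rw [mul_comm _ (w r), ← div_eq_iff hch.ne'] at h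
      rw [← h, Finset.sum_div]
      refine Finset.sum_congr rfl fun k _ => ?_
      have hf : (0 : ℝ) < r.factorial := by exact_mod_cast r.factorial_pos
      rw [Nat.descFactorial_eq_factorial_mul_choose, Nat.descFactorial_eq_factorial_mul_choose]
      simp only [c]
      push_cast
      field_simp
    rw [hint, hwr, ← Finset.sum_sub_distrib, ← hmass n, Finset.sum_mul, Real.norm_eq_abs]
    refine (Finset.abs_sum_le_sum_abs _ _).trans (Finset.sum_le_sum fun k hk => ?_)
    have hkn : k ≤ n := Nat.lt_succ_iff.1 (Finset.mem_range.1 hk)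
    rw [← mul_sub, abs_mul, abs_of_nonneg (hc n k), hpt n k hkn]
    exact mul_le_mul_of_nonneg_left (abs_pow_sub_descFactorial_div_le hkn hn) (hc n k)
  let g : BoundedContinuousFunction unitInterval ℝ :=
    BoundedContinuousFunction.mkOfCompact ⟨fun x => (x : ℝ) ^ r, by fun_prop⟩
  have hcont : Continuous fun ν : FiniteMeasure unitInterval => ∫ x, g x ∂(ν : Measure _) := by
    exact FiniteMeasure.continuous_integral_boundedContinuousFunction g
  have hcl := hP.continuousAt_comp hcont.continuousAt
  obtain ⟨ψ, hψ, hψlim⟩ := hcl.tendsto_subseq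
  exact tendsto_nhds_unique hψlim (hlim.comp hψ.tendsto_atTop)

/-! ### Bernstein's theorem -/

/-- `D 0, D 1, …` are the successive derivatives on `(0, ∞)` of the completely monotone function
`D 0` on `[0, ∞)`. -/
structure IsAlternatingDerivatives (D : ℕ → ℝ → ℝ) : Prop where
  continuousOn : ContinuousOn (D 0) (Ici 0)
  hasDerivAt : ∀ k x, 0 < x → HasDerivAt (D k) (D (k + 1) x) x
  alternating : ∀ k x, 0 < x → 0 ≤ (-1 : ℝ) ^ k * D k x

namespace IsAlternatingDerivatives

variable {D : ℕ → ℝ → ℝ}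

/-- Each `(-1) ^ k * D k` is antitone, its derivative being `-(-1) ^ (k + 1) * D (k + 1)`. Stability
under differencing drives the induction for iterated differences of samples. -/
theorem sub_shift (hD : IsAlternatingDerivatives D) {t : ℝ} (ht : 0 < t) :
    IsAlternatingDerivatives fun k x => D k x - D k (x + t) where
  continuousOn := hD.continuousOn.sub (hD.continuousOn.comp (by fun_prop) fun x hx =>
    show 0 ≤ x + t from add_nonneg hx ht.le)
  hasDerivAt k x hx := (hD.hasDerivAt k x hx).sub
    ((hD.hasDerivAt k (x + t) (add_pos hx ht)).comp_add_const x t)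
  alternating k x hx := by
    have hanti : AntitoneOn (fun y => (-1 : ℝ) ^ k * D k y) (Ioi 0) := by
      have hd : ∀ y ∈ Ioi (0 : ℝ),
          HasDerivAt (fun y => (-1 : ℝ) ^ k * D k y) ((-1 : ℝ) ^ k * D (k + 1) y) y :=
        fun y hy => (hD.hasDerivAt k y hy).const_mul _
      refine antitoneOn_of_deriv_nonpos (convex_Ioi 0)
        (fun y hy => (hd y hy).continuousAt.continuousWithinAt) ?_ ?_
      · rw [interior_Ioi]
        exact fun y hy => (hd y hy).differentiableAt.differentiableWithinAt
      · rw [interior_Ioi]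
        intro y hy
        rw [(hd y hy).deriv]
        have := hD.alternating (k + 1) y hy
        rw [pow_succ] at this
        linarith
    have := hanti hx (add_pos hx ht) (le_add_of_nonneg_right ht.le)
    rw [mul_sub]
    exact sub_nonneg.2 this

theorem nonneg (hD : IsAlternatingDerivatives D) {x : ℝ} (hx : 0 ≤ x) : 0 ≤ D 0 x := by
  have hcl : closure (Ioi (0 : ℝ)) = Ici 0 := closure_Ioi 0
  have hx' : x ∈ closure (Ioi (0 : ℝ)) := hcl ▸ hx
  refine ContinuousWithinAt.closure_le (f := fun _ => (0 : ℝ)) (g := D 0) hx'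
    continuousWithinAt_const ((hD.continuousOn x hx).mono Ioi_subset_Ici_self) fun y hy => ?_
  simpa using hD.alternating 0 y hy

theorem diffEnd_pow_nonneg (hD : IsAlternatingDerivatives D) {t : ℝ} (ht : 0 < t) (n k : ℕ) :
    0 ≤ (diffEnd ^ n) (fun k => D 0 (k * t)) k := by
  induction n generalizing D with
  | zero => exact hD.nonneg (by positivity)
  | succ n ih =>
    rw [pow_succ, Module.End.mul_apply]
    have : diffEnd (fun k => D 0 (k * t)) = fun k : ℕ => D 0 (k * t) - D 0 (k * t + t) := by
      funext k
      rw [diffEnd_apply]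
      congr 2
      push_cast; ring
    rw [this]
    exact ih (hD.sub_shift ht)

/-- **Bernstein's theorem** on completely monotone functions, in the variable `x = exp (-s)`. -/
theorem exists_measure (hD : IsAlternatingDerivatives D) :
    ∃ P : Measure unitInterval, IsFiniteMeasure P ∧ P {0} = 0 ∧
      ∀ q : ℝ, 0 ≤ q → D 0 q = ∫ x, (x : ℝ) ^ q ∂P := by
  have hex : ∀ N : ℕ, ∃ P : Measure unitInterval, IsFiniteMeasure P ∧
      ∀ r : ℕ, ∫ x, (x : ℝ) ^ r ∂P = D 0 (r * ((N : ℝ) + 1)⁻¹) := fun N =>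
    exists_measure_integral_pow_eq (hD.diffEnd_pow_nonneg (by positivity))
  obtain ⟨P, hPfin, hP⟩ := hex 0
  simp only [Nat.cast_zero, zero_add, inv_one, mul_one] at hP
  -- the values at positive rational numbers
  have hrat : ∀ k N : ℕ, D 0 (k / ((N : ℝ) + 1)) = ∫ x, (x : ℝ) ^ ((k : ℝ) / ((N : ℝ) + 1)) ∂P := by
    intro k N
    obtain ⟨Q, hQfin, hQ⟩ := hex N
    have hm : Measurable fun x : unitInterval => x ^ (N + 1) :=
      (continuous_pow (N + 1)).measurable
    -- The image of `Q` under `x ^ (N + 1)` has the moments `D 0 r` of `P`, so determinacy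
    -- identifies the two.
    have hPQ : Q.map (fun x : unitInterval => x ^ (N + 1)) = P := by
      refine ext_of_integral_pow_eq fun r => ?_
      rw [integral_map hm.aemeasurable (Continuous.aestronglyMeasurable (by fun_prop)), hP]
      simp only [Icc.coe_pow, ← pow_mul]
      rw [hQ]
      congr 1
      push_cast
      field_simp
    rw [div_eq_mul_inv, ← hQ k, ← hPQ, integral_map hm.aemeasurable
      (Continuous.aestronglyMeasurable
        (continuous_subtype_val.rpow_const fun x => Or.inr (by positivity)))]
    refine integral_congr_ae (Filter.Eventually.of_forall fun x => ?_)
    simp only [Icc.coe_pow]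
    rw [← Real.rpow_natCast (x : ℝ) (N + 1), ← Real.rpow_mul x.2.1, ← Real.rpow_natCast]
    congr 1
    push_cast
    field_simp
  have hmeas : ∀ q : ℝ, AEStronglyMeasurable (fun x : unitInterval => (x : ℝ) ^ q) P := fun q =>
    (measurable_subtype_coe.pow_const q).aestronglyMeasurable
  have hbound : ∀ q : ℝ, 0 ≤ q → ∀ x : unitInterval, ‖(x : ℝ) ^ q‖ ≤ 1 := fun q hq x => by
    rw [Real.norm_eq_abs, abs_of_nonneg (Real.rpow_nonneg x.2.1 _)]
    exact Real.rpow_le_one x.2.1 x.2.2 hq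
  refine ⟨P, hPfin, ?_, fun q hq => ?_⟩
  -- There is no atom at `0`: the integrals of `x ^ (1 / (N + 1))` tend to the mass off `0`, while
  -- continuity of `D 0` at `0` makes the limit the total mass.
  · have hlim0 : Filter.Tendsto (fun N : ℕ => (1 : ℝ) / ((N : ℝ) + 1)) Filter.atTop (nhds 0) :=
      tendsto_one_div_add_atTop_nhds_zero_nat
    have hl : Filter.Tendsto (fun N : ℕ => D 0 (1 / ((N : ℝ) + 1))) Filter.atTop (nhds (D 0 0)) :=
      (hD.continuousOn 0 self_mem_Ici).tendsto.comp (tendsto_nhdsWithin_iff.2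
        ⟨hlim0, Filter.Eventually.of_forall fun N => show (0 : ℝ) ≤ 1 / ((N : ℝ) + 1) by positivity⟩)
    have hr : Filter.Tendsto (fun N : ℕ => ∫ x : unitInterval, (x : ℝ) ^ (1 / ((N : ℝ) + 1)) ∂P)
        Filter.atTop (nhds (∫ x, ({0}ᶜ : Set unitInterval).indicator (fun _ => (1 : ℝ)) x ∂P)) := by
      refine tendsto_integral_of_dominated_convergence (fun _ => 1) (fun N => hmeas _)
        (integrable_const 1) (fun N => Filter.Eventually.of_forall fun x =>
          hbound _ (by positivity) x) (Filter.Eventually.of_forall fun x => ?_)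
      by_cases hx : x = 0
      · subst hx
        have : ∀ N : ℕ, ((0 : unitInterval) : ℝ) ^ (1 / ((N : ℝ) + 1)) = 0 := fun N => by
          rw [Icc.coe_zero]
          exact Real.zero_rpow (by positivity)
        simpa only [this, indicator_of_notMem (show (0 : unitInterval) ∉ ({0}ᶜ : Set unitInterval) by
          simp)] using tendsto_const_nhds
      · have hx0 : (x : ℝ) ≠ 0 := fun h => hx (Subtype.ext h)
        have h := (Real.continuousAt_const_rpow hx0).tendsto.comp hlim0
        rw [Real.rpow_zero] at h
        rwa [indicator_of_mem (by simpa using hx)]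
    have h1 : D 0 0 = P.real univ := by simpa using (hP 0).symm
    have h2 := tendsto_nhds_unique hl (hr.congr fun N => by simpa using (hrat 1 N).symm)
    rw [integral_indicator_const _ (by measurability), smul_eq_mul, mul_one, h1,
      measureReal_compl (measurableSet_singleton _)] at h2
    have h3 : P.real {0} = 0 := by linarith
    exact (measureReal_eq_zero_iff).1 h3
  · rcases hq.eq_or_lt with rfl | hq0
    · simpa using (hP 0).symm
    · have hseq : Filter.Tendsto (fun N : ℕ => (⌊q * ((N : ℝ) + 1)⌋₊ : ℝ) / ((N : ℝ) + 1))
          Filter.atTop (nhds q) :=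
        (tendsto_nat_floor_mul_div_atTop hq).comp
          (Filter.tendsto_atTop_add_const_right _ 1 tendsto_natCast_atTop_atTop)
      refine tendsto_nhds_unique
        ((hD.hasDerivAt 0 q hq0).continuousAt.tendsto.comp hseq) ?_
      refine Filter.Tendsto.congr (fun N => (hrat _ N).symm) ?_
      refine tendsto_integral_of_dominated_convergence (fun _ => 1) (fun N => hmeas _)
        (integrable_const 1) (fun N => Filter.Eventually.of_forall fun x =>
          hbound _ (by positivity) x) (Filter.Eventually.of_forall fun x => ?_)
      exact (Real.continuousAt_const_rpow' hq0.ne').tendsto.comp hseq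

end IsAlternatingDerivatives

/-! ### Completely monotone functions as Laplace transforms -/

theorem isLocallyFiniteMeasure_of_integrable {X : Type*} [TopologicalSpace X] [MeasurableSpace X]
    [OpensMeasurableSpace X] {μ : Measure X} {g : X → ℝ} (hg : Continuous g) (hpos : ∀ x, 0 < g x)
    (hi : Integrable g μ) : IsLocallyFiniteMeasure μ where
  finiteAtNhds x := by
    refine ⟨{y | g x / 2 < g y}, (isOpen_lt continuous_const hg).mem_nhds ?_, ?_⟩
    · exact half_lt_self (hpos x)
    · exact hi.measure_gt_lt_top (half_pos (hpos x))

theorem isRadon_of_integrable_exp {ν : Measure ℝ} {a : ℝ}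
    (hi : Integrable (fun s => Real.exp (-a * s)) ν) : IsRadon ν := by
  have : IsLocallyFiniteMeasure ν :=
    isLocallyFiniteMeasure_of_integrable (by fun_prop) (fun s => Real.exp_pos _) hi
  exact ⟨this, inferInstance⟩

theorem integrable_exp_withDensity_iff (ν : Measure ℝ) (a b : ℝ) :
    Integrable (fun s => Real.exp (-b * s))
      (ν.withDensity fun s => ENNReal.ofReal (Real.exp (-a * s)))
      ↔ Integrable (fun s => Real.exp (-(a + b) * s)) ν := by
  rw [integrable_withDensity_iff_integrable_smul' (by fun_prop)
    (Filter.Eventually.of_forall fun _ => ENNReal.ofReal_lt_top)]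
  refine integrable_congr (Filter.Eventually.of_forall fun s => ?_)
  simp only [smul_eq_mul]
  rw [ENNReal.toReal_ofReal (Real.exp_pos _).le, ← Real.exp_add]
  congr 1; ring

theorem IsCompletelyMonotone.isAlternatingDerivatives {a : ℝ} {f : Ici a → ℝ≥0}
    (hf : IsCompletelyMonotone f) : IsAlternatingDerivatives fun k x =>
      iteratedDeriv k (IciExtend fun x => (f x : ℝ)) (x + a) where
  continuousOn := by
    simp only [iteratedDeriv_zero]
    have : Continuous (IciExtend fun x => (f x : ℝ)) :=
      (NNReal.continuous_coe.comp hf.continuous).comp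
        (Continuous.subtype_mk (continuous_const.max continuous_id) _)
    exact (this.comp (continuous_add_const a)).continuousOn
  hasDerivAt k x hx := by
    have hx' : x + a ∈ Ioi a := lt_add_of_pos_left a hx
    refine HasDerivAt.comp_add_const x a ?_
    rw [iteratedDeriv_succ]
    refine DifferentiableAt.hasDerivAt ?_
    have h := (hf.smooth.differentiableOn_iteratedDerivWithin (m := k)
      (by exact_mod_cast WithTop.coe_lt_top _) (uniqueDiffOn_Ioi a)).differentiableAt
      (isOpen_Ioi.mem_nhds hx')
    refine h.congr_of_eventuallyEq ?_
    filter_upwards [isOpen_Ioi.mem_nhds hx'] with y hy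
    exact (iteratedDerivWithin_of_isOpen isOpen_Ioi hy).symm
  alternating k x hx := hf.alternating k (x + a) (lt_add_of_pos_left a hx)

/-- **Bernstein's theorem**: a completely monotone function on `[a, ∞)` is the Laplace transform of
a measure. -/
theorem IsCompletelyMonotone.exists_isLaplaceMeasure {a : ℝ} {f : Ici a → ℝ≥0}
    (hf : IsCompletelyMonotone f) : ∃ ν : Measure ℝ, IsLaplaceMeasure f ν := by
  obtain ⟨P, hPfin, hP0, hP⟩ := hf.isAlternatingDerivatives.exists_measure
  have hlog : Measurable fun x : unitInterval => -Real.log x := by fun_prop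
  set m : Measure ℝ := P.map fun x : unitInterval => -Real.log x with hm
  have hm0 : m (Ici (0 : ℝ))ᶜ = 0 := by
    rw [hm, Measure.map_apply hlog measurableSet_Ici.compl]
    refine measure_mono_null (t := ∅) (fun x hx => hx ?_) measure_empty
    exact neg_nonneg.2 (Real.log_nonpos x.2.1 x.2.2)
  have hcongr : ∀ q : ℝ, (fun x : unitInterval => Real.exp (-q * -Real.log x))
      =ᵐ[P] fun x => (x : ℝ) ^ q := by
    intro q
    -- As `Real.log 0 = 0`, an atom at `x = 0` would be sent to `s = 0`; `P {0} = 0` excludes this.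
    have : ∀ᵐ x ∂P, x ≠ 0 := measure_eq_zero_iff_ae_notMem.1 hP0
    filter_upwards [this] with x hx
    have hx0 : 0 < (x : ℝ) := lt_of_le_of_ne x.2.1 fun h => hx (Subtype.ext h.symm)
    rw [Real.rpow_def_of_pos hx0]
    congr 1; ring
  have hint0 : Integrable (fun s => Real.exp (-0 * s)) m := by
    have : IsFiniteMeasure m := Measure.isFiniteMeasure_map _ _
    simp
  -- `m` represents the translate `x ↦ f (x + a)`; the density `exp (a s)` undoes the translation.
  set ν : Measure ℝ := m.withDensity fun s => ENNReal.ofReal (Real.exp (-(-a) * s)) with hν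
  have hint : ∀ x : Ici a, Integrable (fun s : ℝ => Real.exp (-(x : ℝ) * s)) ν := fun x =>
    (integrable_exp_withDensity_iff m (-a) x).2
      (integrable_exp_of_le hm0 (by have := x.2; rw [mem_Ici] at this; linarith) hint0)
  refine ⟨ν, withDensity_absolutelyContinuous _ _ hm0,
    isRadon_of_integrable_exp (hint ⟨a, self_mem_Ici⟩), hint, fun x => ?_⟩
  have hxa : 0 ≤ -a + (x : ℝ) := by have := x.2; rw [mem_Ici] at this; linarith
  rw [hν, integral_exp_withDensity, hm, integral_map hlog.aemeasurable
    (Continuous.aestronglyMeasurable (by fun_prop)), integral_congr_ae (hcongr _), ← hP _ hxa,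
    iteratedDeriv_zero, show -a + (x : ℝ) + a = x by ring, IciExtend_coe]

/-- The Laplace transform of a measure is completely monotone. -/
theorem exists_isCompletelyMonotone {ν : Measure ℝ} {a : ℝ} (h0 : ν (Ici (0 : ℝ))ᶜ = 0)
    (hi : Integrable (fun s => Real.exp (-a * s)) ν) :
    ∃ f : Ici a → ℝ≥0, IsCompletelyMonotone f ∧ IsLaplaceMeasure f ν := by
  have hint : ∀ x : Ici a, Integrable (fun s : ℝ => Real.exp (-(x : ℝ) * s)) ν := fun x =>
    integrable_exp_of_le h0 x.2 hi
  let f : Ici a → ℝ≥0 := fun x =>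
    ⟨∫ s, Real.exp (-(x : ℝ) * s) ∂ν, integral_nonneg fun s => (Real.exp_pos _).le⟩
  refine ⟨f, ?_, h0, isRadon_of_integrable_exp hi, hint, fun x => rfl⟩
  -- The transform is the moment generating function of `-s`, analytic inside its integrability set,
  -- with `k`-th derivative the integral of `(-s) ^ k * exp (-x s)`. Continuity at `a` is obtained
  -- separately, by domination.
  have hmem : Ioi a ⊆ interior (ProbabilityTheory.integrableExpSet (fun s : ℝ => -s) ν) := by
    refine interior_maximal (fun x hx => ?_) isOpen_Ioi
    refine (hint ⟨x, Ioi_subset_Ici_self hx⟩).congr (Filter.Eventually.of_forall fun s => ?_)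
    simp only [neg_mul, mul_neg]
  have heq : EqOn (IciExtend fun x => (f x : ℝ))
      (ProbabilityTheory.mgf (fun s : ℝ => -s) ν) (Ioi a) := by
    intro x hx
    rw [IciExtend_of_mem _ (Ioi_subset_Ici_self hx)]
    change ∫ s, Real.exp (-x * s) ∂ν = ∫ s, Real.exp (x * -s) ∂ν
    simp only [neg_mul, mul_neg]
  refine ⟨?_, ?_, fun k x hx => ?_⟩
  · refine Continuous.subtype_mk ?_ _
    refine continuous_of_dominated (bound := fun s => Real.exp (-a * s))
      (fun x => (hint x).aestronglyMeasurable) (fun x => ?_) hi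
      (Filter.Eventually.of_forall fun s => by fun_prop)
    filter_upwards [ae_nonneg_of_concentrated h0] with s hs
    rw [Real.norm_eq_abs, Real.abs_exp]
    have := x.2
    rw [mem_Ici] at this
    exact Real.exp_le_exp.2 (by nlinarith)
  · refine ContDiffOn.congr (f := ProbabilityTheory.mgf (fun s : ℝ => -s) ν) ?_ heq
    exact (ProbabilityTheory.analyticOnNhd_mgf.mono hmem).contDiffOn (uniqueDiffOn_Ioi a)
  · have hev : (IciExtend fun x => (f x : ℝ)) =ᶠ[nhds x]
        ProbabilityTheory.mgf (fun s : ℝ => -s) ν :=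
      Filter.eventuallyEq_of_mem (isOpen_Ioi.mem_nhds hx) heq
    rw [hev.iteratedDeriv_eq, ProbabilityTheory.iteratedDeriv_mgf (hmem hx),
      ← integral_const_mul]
    refine integral_nonneg_of_ae ?_
    filter_upwards [ae_nonneg_of_concentrated h0] with s hs
    rw [← mul_assoc, ← mul_pow]
    have : 0 ≤ -1 * -s := by linarith
    positivity

/-! ### Passage between `(0, 1]` and `[0, ∞)` -/

theorem negLogPushforward_compl_Ici (μ : Measure ℝ) : negLogPushforward μ (Ici (0 : ℝ))ᶜ = 0 := by
  rw [negLogPushforward, Measure.map_apply (by fun_prop) measurableSet_Ici.compl,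
    Measure.restrict_apply ((by fun_prop : Measurable fun t => -Real.log t)
      measurableSet_Ici.compl)]
  refine measure_mono_null (t := ∅) (fun t ht => ht.1 ?_) measure_empty
  exact neg_nonneg.2 (Real.log_nonpos ht.2.1.le ht.2.2)

theorem exp_mul_negLog_ae_eq (μ : Measure ℝ) (x : ℝ) :
    (fun t => Real.exp (-x * -Real.log t)) =ᵐ[μ.restrict (Ioc 0 1)] fun t => t ^ x := by
  filter_upwards [ae_restrict_mem measurableSet_Ioc] with t ht
  rw [Real.rpow_def_of_pos ht.1]
  congr 1; ring

theorem integrable_exp_negLogPushforward {μ : Measure ℝ} {x : ℝ}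
    (h : Integrable (fun t => t ^ x) μ) :
    Integrable (fun s => Real.exp (-x * s)) (negLogPushforward μ) := by
  rw [negLogPushforward, integrable_map_measure (Continuous.aestronglyMeasurable (by fun_prop))
    (by fun_prop)]
  exact h.restrict.congr (exp_mul_negLog_ae_eq μ x).symm

theorem integral_exp_negLogPushforward (μ : Measure ℝ) (x : ℝ) :
    ∫ s, Real.exp (-x * s) ∂(negLogPushforward μ) = ∫ t in Ioc 0 1, t ^ x ∂μ := by
  rw [negLogPushforward, integral_map (by fun_prop) (Continuous.aestronglyMeasurable (by fun_prop))]
  exact integral_congr_ae (exp_mul_negLog_ae_eq μ x)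

/-- For `x ≠ 0` the integrand vanishes at `0`, so the mass of `{0}` does not matter. -/
theorem setIntegral_Ioc_rpow {μ : Measure ℝ} (hμ : μ (Icc (0 : ℝ) 1)ᶜ = 0) {x : ℝ} (hx : x ≠ 0) :
    ∫ t in Ioc 0 1, t ^ x ∂μ = ∫ t, t ^ x ∂μ := by
  refine setIntegral_eq_integral_of_ae_compl_eq_zero ?_
  have : ∀ᵐ t ∂μ, t ∈ Icc (0 : ℝ) 1 := hμ
  filter_upwards [this] with t ht hn
  have : t = 0 := le_antisymm (not_lt.1 fun h => hn ⟨h, ht.2⟩) ht.1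
  rw [this, Real.zero_rpow hx]

theorem log_natCast_ne_zero {n : ℕ} (hn : 2 ≤ n) : Real.log n ≠ 0 :=
  (Real.log_pos (by exact_mod_cast hn)).ne'

theorem isRadon_comap_of_integrable_rpow {μ : Measure ℝ} {x : ℝ}
    (h : Integrable (fun t => t ^ x) μ) :
    IsRadon (μ.comap (Subtype.val : Ioc (0 : ℝ) 1 → ℝ)) := by
  have hi : Integrable (fun t : Ioc (0 : ℝ) 1 => (t : ℝ) ^ x) (μ.comap Subtype.val) := by
    have := (MeasurableEmbedding.subtype_coe (measurableSet_Ioc (a := (0 : ℝ)) (b := 1)))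
      |>.integrable_map_iff (μ := μ.comap Subtype.val) (g := fun t => t ^ x)
    rw [map_comap_subtype_coe measurableSet_Ioc] at this
    exact this.1 h.restrict
  have hcont : Continuous fun t : Ioc (0 : ℝ) 1 => (t : ℝ) ^ x :=
    continuous_subtype_val.rpow_const fun t => Or.inl t.2.1.ne'
  have := isLocallyFiniteMeasure_of_integrable hcont (fun t => Real.rpow_pos_of_pos t.2.1 x) hi
  have : LocallyCompactSpace (Ioc (0 : ℝ) 1) := isLocallyClosed_Ioc.locallyCompactSpace
  exact ⟨inferInstance, inferInstance⟩

/-- A Laplace transform `∫ exp (-log n * s) ν(ds)` plus an atom at `0` gives a Hausdorff log-moment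
sequence. -/
theorem isRepresentingMeasure_map_exp_add_dirac {j : ℕ} {w : ℕ → ℝ} {ν : Measure ℝ} {c : ℝ}
    (hc : 0 ≤ c) (h0 : ν (Ici (0 : ℝ))ᶜ = 0)
    (hi : ∀ n : ℕ, j ≤ n → Integrable (fun s => Real.exp (-Real.log n * s)) ν)
    (hw : ∀ n : ℕ, j ≤ n → w n = ∫ s, Real.exp (-Real.log n * s) ∂ν + c * 0 ^ Real.log n) :
    IsRepresentingMeasure j w
      (ν.map (fun s => Real.exp (-s)) + ENNReal.ofReal c • Measure.dirac 0) := by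
  have hexp : Measurable fun s : ℝ => Real.exp (-s) := by fun_prop
  have hpow : ∀ x : ℝ, (fun s : ℝ => Real.exp (-s) ^ x) = fun s => Real.exp (-x * s) := by
    intro x; funext s
    rw [← Real.exp_mul]
    congr 1; ring
  have hmeas : ∀ (x : ℝ) (m : Measure ℝ), AEStronglyMeasurable (fun t : ℝ => t ^ x) m := fun x m =>
    (measurable_id.pow_const x).aestronglyMeasurable
  have hint₁ : ∀ n : ℕ, j ≤ n → Integrable (fun t : ℝ => t ^ Real.log n)
      (ν.map fun s => Real.exp (-s)) := fun n hn => by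
    rw [integrable_map_measure (hmeas _ _) hexp.aemeasurable, Function.comp_def, hpow]
    exact hi n hn
  have hint₂ : ∀ n : ℕ, Integrable (fun t : ℝ => t ^ Real.log n)
      (ENNReal.ofReal c • Measure.dirac (0 : ℝ)) := fun n =>
    (integrable_dirac (by simp)).smul_measure ENNReal.ofReal_ne_top
  have hint : ∀ n : ℕ, j ≤ n → Integrable (fun t : ℝ => t ^ Real.log n)
      (ν.map (fun s => Real.exp (-s)) + ENNReal.ofReal c • Measure.dirac 0) := fun n hn =>
    (hint₁ n hn).add_measure (hint₂ n)
  refine ⟨?_, isRadon_comap_of_integrable_rpow (hint j le_rfl), hint, fun n hn => ?_⟩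
  · rw [Measure.add_apply, Measure.map_apply hexp measurableSet_Icc.compl, Measure.smul_apply,
      Measure.dirac_apply' _ measurableSet_Icc.compl]
    have : ν ((fun s => Real.exp (-s)) ⁻¹' (Icc (0 : ℝ) 1)ᶜ) = 0 := by
      refine measure_mono_null (t := (Ici (0 : ℝ))ᶜ) (fun s hs (hs0 : 0 ≤ s) => hs ?_) h0
      exact ⟨(Real.exp_pos _).le, Real.exp_le_one_iff.2 (neg_nonpos.2 hs0)⟩
    rw [this]
    simp
  · rw [integral_add_measure (hint₁ n hn) (hint₂ n), integral_map hexp.aemeasurable (hmeas _ _),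
      hpow, integral_smul_measure, integral_dirac, ENNReal.toReal_ofReal hc, smul_eq_mul, hw n hn]

/-! ### Interpolation and uniqueness -/

/-- Completely monotone functions agreeing at `log n` for all `n > j` have the same representing
measures. -/
theorem IsLaplaceMeasure.eq_of_eq_log {j : ℕ} (hj : 1 ≤ j) {a : ℝ} (ha : a = Real.log j)
    {f g : Ici a → ℝ≥0} {ν₁ ν₂ : Measure ℝ} (h₁ : IsLaplaceMeasure f ν₁)
    (h₂ : IsLaplaceMeasure g ν₂)
    (h : ∀ (n : ℕ) (hn : Real.log n ∈ Ici a), j < n → f ⟨Real.log n, hn⟩ = g ⟨Real.log n, hn⟩) :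
    ν₁ = ν₂ := by
  subst ha
  refine ext_of_integral_exp_log_eq hj h₁.concentrated h₂.concentrated
    (h₁.integrable ⟨_, self_mem_Ici⟩) (h₂.integrable ⟨_, self_mem_Ici⟩) fun n hn => ?_
  have hmem : Real.log n ∈ Ici (Real.log j) := log_mem_Ici hn.le
  rw [← h₁.laplace ⟨_, hmem⟩, ← h₂.laplace ⟨_, hmem⟩, h n hmem hn]

theorem IsLaplaceMeasure.function_eq {a : ℝ} {f g : Ici a → ℝ≥0} {ν : Measure ℝ}
    (hf : IsLaplaceMeasure f ν) (hg : IsLaplaceMeasure g ν) : f = g :=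
  funext fun x => NNReal.coe_injective (by rw [hf.laplace, hg.laplace])

/-- Bernstein supplies measures, which Müntz identifies. The node `j` is left out because for `j =
1` the value `w 1` does not prescribe `f 0`. The variable `a` lets the lemma apply to `Ici 0` as
well as to `Ici (log j)`. -/
theorem IsCompletelyMonotone.eq_of_eq_log {j : ℕ} (hj : 1 ≤ j) {a : ℝ} (ha : a = Real.log j)
    {f g : Ici a → ℝ≥0} (hf : IsCompletelyMonotone f) (hg : IsCompletelyMonotone g)
    (h : ∀ (n : ℕ) (hn : Real.log n ∈ Ici a), j < n → f ⟨Real.log n, hn⟩ = g ⟨Real.log n, hn⟩) :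
    f = g := by
  obtain ⟨ν₁, h₁⟩ := hf.exists_isLaplaceMeasure
  obtain ⟨ν₂, h₂⟩ := hg.exists_isLaplaceMeasure
  obtain rfl := h₁.eq_of_eq_log hj ha h₂ h
  exact h₁.function_eq h₂

namespace IsRepresentingMeasure

variable {j : ℕ} {w : ℕ → ℝ} {μ : Measure ℝ}

theorem integral_negLogPushforward (hμ : IsRepresentingMeasure j w μ) {n : ℕ} (hn : 2 ≤ n)
    (hjn : j ≤ n) : ∫ s, Real.exp (-Real.log n * s) ∂(negLogPushforward μ) = w n := by
  rw [integral_exp_negLogPushforward,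
    setIntegral_Ioc_rpow hμ.concentrated (log_natCast_ne_zero hn), hμ.moment n hjn]

theorem exists_isLaplaceMeasure (hμ : IsRepresentingMeasure j w μ) {a : ℝ} (ha : a = Real.log j) :
    ∃ f : Ici a → ℝ≥0, IsCompletelyMonotone f ∧ IsLaplaceMeasure f (negLogPushforward μ) :=
  exists_isCompletelyMonotone (negLogPushforward_compl_Ici μ)
    (integrable_exp_negLogPushforward (ha ▸ hμ.integrable j le_rfl))

/-- The transform of the pushforward is completely monotone and agrees with `f` at the nodes beyond
`j`, hence equals `f`. -/
theorem isLaplaceMeasure_iff (hj : 1 ≤ j) (hμ : IsRepresentingMeasure j w μ) {a : ℝ}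
    (ha : a = Real.log j) {f : Ici a → ℝ≥0} (hf : IsCompletelyMonotone f)
    (hw : ∀ (n : ℕ) (hn : Real.log n ∈ Ici a), j < n → w n = f ⟨Real.log n, hn⟩) (ν : Measure ℝ) :
    IsLaplaceMeasure f ν ↔ ν = negLogPushforward μ := by
  obtain ⟨g, hg, hgν⟩ := hμ.exists_isLaplaceMeasure ha
  have heq : f = g := hf.eq_of_eq_log hj ha hg fun n hn hjn => by
    apply NNReal.coe_injective
    rw [← hw n hn hjn, hgν.laplace, hμ.integral_negLogPushforward (by omega) hjn.le]
  subst heq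
  constructor
  · exact fun h => h.eq_of_eq_log hj ha hgν fun _ _ _ => rfl
  · rintro rfl
    exact hgν

/-- At `n = 1` the integrand is the constant `1`, also at `t = 0`. -/
theorem isFiniteMeasure (hμ : IsRepresentingMeasure 1 w μ) : IsFiniteMeasure μ := by
  have h := hμ.integrable 1 le_rfl
  simp only [Nat.cast_one, Real.log_one, Real.rpow_zero] at h
  exact (integrable_const_iff_isFiniteMeasure one_ne_zero).1 h

theorem laplace_zero (hμ : IsRepresentingMeasure 1 w μ) {f : Ici (0 : ℝ) → ℝ≥0}
    (hf : IsLaplaceMeasure f (negLogPushforward μ)) :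
    (f ⟨0, self_mem_Ici⟩ : ℝ) = w 1 - μ.real {0} := by
  have := hμ.isFiniteMeasure
  rw [hf.laplace, hμ.moment 1 le_rfl, integral_exp_negLogPushforward]
  simp only [Nat.cast_one, Real.log_one, Real.rpow_zero, integral_const, smul_eq_mul, mul_one,
    measureReal_restrict_apply_univ]
  have h1 : μ.real univ = μ.real (Icc 0 1) :=
    measureReal_congr (ae_eq_univ.2 hμ.concentrated).symm
  have h2 : Icc (0 : ℝ) 1 = {0} ∪ Ioc 0 1 := by
    rw [union_comm, Ioc_union_left zero_le_one]
  rw [h1, h2, measureReal_union (by simp) measurableSet_Ioc]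
  ring

end IsRepresentingMeasure

theorem InterpolatesFromOne.eq_log {w : ℕ → ℝ} {f : Ici (0 : ℝ) → ℝ≥0}
    (hf : InterpolatesFromOne w f) (n : ℕ) (hn : Real.log n ∈ Ici (0 : ℝ)) (h : 1 < n) :
    w n = f ⟨Real.log n, hn⟩ := by
  rw [hf.2.2 n h.le, indicator_of_notMem (by simpa using h.ne'), mul_zero, zero_add]

theorem zero_eq_log_one : (0 : ℝ) = Real.log (1 : ℕ) := by simp

theorem InterpolatesFromOne.unique {w : ℕ → ℝ} {f g : Ici (0 : ℝ) → ℝ≥0}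
    (hf : InterpolatesFromOne w f) (hg : InterpolatesFromOne w g) : f = g :=
  hf.1.eq_of_eq_log le_rfl zero_eq_log_one hg.1 fun n hn h =>
    NNReal.coe_injective ((hf.eq_log n hn h).symm.trans (hg.eq_log n hn h))

theorem InterpolatesFrom.unique {j : ℕ} (hj : 1 ≤ j) {w : ℕ → ℝ} {f g : Ici (Real.log j) → ℝ≥0}
    (hf : InterpolatesFrom j w f) (hg : InterpolatesFrom j w g) : f = g :=
  hf.1.eq_of_eq_log hj rfl hg.1 fun n _ h =>
    NNReal.coe_injective ((hf.2 n h.le).symm.trans (hg.2 n h.le))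

theorem InterpolatesFromOne.exists_isRepresentingMeasure {w : ℕ → ℝ} {f : Ici (0 : ℝ) → ℝ≥0}
    (hf : InterpolatesFromOne w f) : ∃ μ : Measure ℝ, IsRepresentingMeasure 1 w μ := by
  obtain ⟨ν, hν⟩ := hf.1.exists_isLaplaceMeasure
  refine ⟨_, isRepresentingMeasure_map_exp_add_dirac (c := w 1 - f ⟨0, self_mem_Ici⟩)
    (sub_nonneg.2 hf.2.1) hν.concentrated
    (fun n _ => hν.integrable ⟨Real.log n, Real.log_natCast_nonneg n⟩) fun n hn => ?_⟩
  rw [← hν.laplace ⟨Real.log n, Real.log_natCast_nonneg n⟩, hf.2.2 n hn, add_comm]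
  congr 2
  -- `0 ^ log n` is `1` at `n = 1` and `0` beyond, so the atom of mass `w 1 - f 0` produces exactly
  -- the indicator term.
  rcases hn.eq_or_lt with rfl | h
  · simp
  · rw [indicator_of_notMem (by simpa using h.ne'), Real.zero_rpow (log_natCast_ne_zero h)]

theorem InterpolatesFrom.exists_isRepresentingMeasure {j : ℕ} {w : ℕ → ℝ}
    {f : Ici (Real.log j) → ℝ≥0} (hf : InterpolatesFrom j w f) :
    ∃ μ : Measure ℝ, IsRepresentingMeasure j w μ := by
  obtain ⟨ν, hν⟩ := hf.1.exists_isLaplaceMeasure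
  refine ⟨_, isRepresentingMeasure_map_exp_add_dirac (c := 0) le_rfl hν.concentrated
    (fun n hn => hν.integrable ⟨Real.log n, log_mem_Ici hn⟩) fun n hn => ?_⟩
  rw [hf.2 n hn, hν.laplace, zero_mul, add_zero]

theorem IsRepresentingMeasure.exists_interpolatesFromOne {w : ℕ → ℝ} {μ : Measure ℝ}
    (hμ : IsRepresentingMeasure 1 w μ) : ∃ f, InterpolatesFromOne w f := by
  obtain ⟨f, hf, hν⟩ := hμ.exists_isLaplaceMeasure zero_eq_log_one
  refine ⟨f, hf, ?_, fun n hn => ?_⟩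
  · rw [hμ.laplace_zero hν]
    exact sub_le_self _ measureReal_nonneg
  · rcases hn.eq_or_lt with rfl | h
    · simp
    · rw [indicator_of_notMem (by simpa using h.ne'), mul_zero, zero_add, hν.laplace,
        hμ.integral_negLogPushforward h hn]

theorem IsRepresentingMeasure.exists_interpolatesFrom {j : ℕ} (hj : 2 ≤ j) {w : ℕ → ℝ}
    {μ : Measure ℝ} (hμ : IsRepresentingMeasure j w μ) : ∃ f, InterpolatesFrom j w f := by
  obtain ⟨f, hf, hν⟩ := hμ.exists_isLaplaceMeasure rfl
  exact ⟨f, hf, fun n hn => by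
    rw [hν.laplace, hμ.integral_negLogPushforward (hj.trans hn) hn]⟩

end HausdorffLog

theorem mainTheorem1 :
    (∀ w : ℕ → ℝ, (∀ n : ℕ, 1 ≤ n → 0 ≤ w n) →
      (HausdorffLog.IsHausdorffLogMoment 1 w ↔
          ∃! f : Ici (0 : ℝ) → ℝ≥0, HausdorffLog.InterpolatesFromOne w f) ∧
      ((∃ f : Ici (0 : ℝ) → ℝ≥0, HausdorffLog.InterpolatesFromOne w f) →
          HausdorffLog.IsHausdorffLogMoment 1 w) ∧
      ∀ (μ : Measure ℝ) (f : Ici (0 : ℝ) → ℝ≥0),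
        HausdorffLog.IsRepresentingMeasure 1 w μ → HausdorffLog.InterpolatesFromOne w f →
          μ {0} ≠ ⊤ ∧ (f ⟨0, self_mem_Ici⟩ : ℝ) = w 1 - μ.real {0} ∧
          ∀ ν : Measure ℝ,
            HausdorffLog.IsLaplaceMeasure f ν ↔ ν = HausdorffLog.negLogPushforward μ) ∧
    (∀ j : ℕ, 2 ≤ j → ∀ w : ℕ → ℝ, (∀ n : ℕ, j ≤ n → 0 ≤ w n) →
      (HausdorffLog.IsHausdorffLogMoment j w ↔
          ∃! f : Ici (Real.log j) → ℝ≥0, HausdorffLog.InterpolatesFrom j w f) ∧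
      ((∃ f : Ici (Real.log j) → ℝ≥0, HausdorffLog.InterpolatesFrom j w f) →
          HausdorffLog.IsHausdorffLogMoment j w) ∧
      ∀ (μ : Measure ℝ) (f : Ici (Real.log j) → ℝ≥0),
        HausdorffLog.IsRepresentingMeasure j w μ → HausdorffLog.InterpolatesFrom j w f →
          ∀ ν : Measure ℝ,
            HausdorffLog.IsLaplaceMeasure f ν ↔ ν = HausdorffLog.negLogPushforward μ) := by
  open HausdorffLog in
  refine ⟨fun w hw => ⟨⟨?_, ?_⟩, ?_, fun μ f hμ hf => ?_⟩,
    fun j hj w hw => ⟨⟨?_, ?_⟩, ?_, fun μ f hμ hf => ?_⟩⟩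
  · rintro ⟨-, μ, hμ⟩
    obtain ⟨f, hf⟩ := hμ.exists_interpolatesFromOne
    exact ⟨f, hf, fun g hg => InterpolatesFromOne.unique hg hf⟩
  · rintro ⟨f, hf, -⟩
    exact ⟨hw, InterpolatesFromOne.exists_isRepresentingMeasure hf⟩
  · rintro ⟨f, hf⟩
    exact ⟨hw, hf.exists_isRepresentingMeasure⟩
  · have hiff := hμ.isLaplaceMeasure_iff le_rfl zero_eq_log_one hf.1 hf.eq_log
    have := hμ.isFiniteMeasure
    exact ⟨measure_ne_top μ _, hμ.laplace_zero ((hiff _).2 rfl), hiff⟩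
  · rintro ⟨-, μ, hμ⟩
    obtain ⟨f, hf⟩ := hμ.exists_interpolatesFrom hj
    exact ⟨f, hf, fun g hg => InterpolatesFrom.unique (by omega) hg hf⟩
  · rintro ⟨f, hf, -⟩
    exact ⟨hw, InterpolatesFrom.exists_isRepresentingMeasure hf⟩
  · rintro ⟨f, hf⟩
    exact ⟨hw, hf.exists_isRepresentingMeasure⟩
  · exact hμ.isLaplaceMeasure_iff (by omega) rfl hf.1 fun n _ hn => hf.2 n hn.le
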